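/- Let $n\ge 1$ and $m\ge 2$. Let $D\subset\mathbb{C}$ be the closed unit disk, on which the cyclic group $\mathbb{Z}_m$ (the $m$-th roots of unity) acts by rotations about the center. The orbifold braid group $\mathrm{Z}_n(D_{\mathbb{Z}_m})$ is the orbifold fundamental group of the orbifold configuration space $$\mathrm{Conf}_n=\{(x_1,\dots,x_n)\in D^n \mid x_i\ne g x_j \text{ for all } i\neq j,\ g\in\mathbb{Z}_m\}$$ with respect to the action of $W=\mathbb{Z}_m^n\rtimes S_n$: its elements are the pairs $(w,[c])$, where $w\in W$ and $[c]$ is the homotopy class (relative to the end points) of a path $c$ in $\mathrm{Conf}_n$ from the base point $p$ to $w p$, with product $(w,[c])(w',[c'])=(ww',[c\cdot (w c')])$. Take $p=(p_1,\dots,p_n)$ with $p_i=\frac{i}{n+1}$, put $W\ni(g,\sigma)\colon x\mapsto (g_i x_{\sigma^{-1}(i)})_i$, and consider the following elements. * $u$: the first strand is $t\mapsto p_1e^{2\pi i t/m}$, the other strands are constant, and the group element is $((e^{2\pi i/m},1,\dots,1),\mathrm{id})$; that is, the first strand encircles the cone point once. * $h_j$ for $1\le j<n$: the strands $j$ and $j+1$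 change places by a counterclockwise half twist inside a fundamental sector, namely with $q=\frac{j+1/2}{n+1}$, $r=\frac{1}{2(n+1)}$, $\varphi(t)=\frac{\pi}{2m}\sin \pi t$ the strands $j$ and $j+1$ are $t\mapsto (q-r\cos\pi t)e^{-i\varphi(t)}$ and $t\mapsto (q+r\cos\pi t)e^{i\varphi(t)}$, the other strands are constant, and the group element is the transposition $(j\ \,j+1)$. For $1\le j\le n$ let $\gamma_j=h_{j-1}\cdots h_1\,u\,h_1\cdots h_{j-1}$, and let $\theta_n=\gamma_n\gamma_{n-1}\cdots\gamma_1$. Then $\theta_n$ lies in the center of $\mathrm{Z}_n(D_{\mathbb{Z}_m})$. Moreover, if $n\ge 2$, then $\theta_n$ has infinite order. -/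

import Mathlib

open scoped unitInterval

noncomputable section

/-! ### The orbifold fundamental group of a group action -/

/-- The orbifold fundamental group, based at `x₀`, of the quotient orbifold `X_G` of a space `X` by
an action of the (discrete) group `G`.  An element is a `G`-loop up to homotopy: a group element
`g : G` together with the homotopy class, relative to the end points, of a path in `X` from `x₀`
to `g • x₀`. -/
structure OrbifoldFundamentalGroup (G : Type*) {X : Type*} [Group G] [TopologicalSpace X]
    [MulAction G X] (x₀ : X) where
  elt : G
  cls : Path.Homotopic.Quotient x₀ (elt • x₀)

namespace OrbifoldFundamentalGroup

variable {G X : Type*} [Group G] [TopologicalSpace X] [MulAction G X] {x₀ : X}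

/-- The class of the `G`-loop given by `g : G` and a path from `x₀` to `g • x₀`. -/
def ofPath (g : G) (p : Path x₀ (g • x₀)) : OrbifoldFundamentalGroup G x₀ :=
  ⟨g, Path.Homotopic.Quotient.mk p⟩

theorem ofPath_surjective (a : OrbifoldFundamentalGroup G x₀) :
    ∃ (g : G) (p : Path x₀ (g • x₀)), a = ofPath g p := by
  obtain ⟨g, c⟩ := a
  obtain ⟨p, rfl⟩ := Path.Homotopic.Quotient.mk_surjective c
  exact ⟨g, p, rfl⟩

theorem mk_eq_mk {g g' : G} {c : Path.Homotopic.Quotient x₀ (g • x₀)}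
    {c' : Path.Homotopic.Quotient x₀ (g' • x₀)} (hg : g = g')
    (h : c = c'.cast rfl (by rw [hg])) :
    (⟨g, c⟩ : OrbifoldFundamentalGroup G x₀) = ⟨g', c'⟩ := by
  subst hg
  simp at h
  rw [h]

theorem trans_cast {x y z y' z' : X} (a : Path.Homotopic.Quotient x y)
    (b : Path.Homotopic.Quotient y' z') (hy : y = y') (hz : z = z') :
    a.trans (b.cast hy hz) = ((a.cast rfl hy.symm).trans b).cast rfl hz := by
  subst hy; subst hz; simp

theorem cast_trans {x y z x' y' : X} (a : Path.Homotopic.Quotient x' y')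
    (b : Path.Homotopic.Quotient y z) (hx : x = x') (hy : y = y') :
    (a.cast hx hy).trans b = (a.trans (b.cast hy.symm rfl)).cast hx rfl := by
  subst hx; subst hy; simp

/-- The translate by `g` of a homotopy class of paths. -/
def translate [ContinuousConstSMul G X] (g : G) {x y : X} (c : Path.Homotopic.Quotient x y) :
    Path.Homotopic.Quotient (g • x) (g • y) :=
  c.map ⟨fun z => g • z, continuous_const_smul g⟩

variable [ContinuousConstSMul G X]

theorem translate_mk (g : G) {x y : X} (p : Path x y) :
    translate g (Path.Homotopic.Quotient.mk p) =
      Path.Homotopic.Quotient.mk (p.map (continuous_const_smul g)) := rfl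

theorem translate_trans (g : G) {x y z : X} (a : Path.Homotopic.Quotient x y)
    (b : Path.Homotopic.Quotient y z) :
    translate g (a.trans b) = (translate g a).trans (translate g b) := by
  induction a using Path.Homotopic.Quotient.ind with | mk a =>
  induction b using Path.Homotopic.Quotient.ind with | mk b =>
  rw [← Path.Homotopic.Quotient.mk_trans, translate_mk, translate_mk, translate_mk,
    Path.map_trans]
  rfl

theorem translate_cast (g : G) {x y x' y' : X} (a : Path.Homotopic.Quotient x y) (hx : x' = x)
    (hy : y' = y) :
    translate g (a.cast hx hy) = (translate g a).cast (by rw [hx]) (by rw [hy]) := by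
  subst hx; subst hy; simp

theorem translate_refl (g : G) (x : X) :
    translate g (Path.Homotopic.Quotient.refl x) = Path.Homotopic.Quotient.refl (g • x) := rfl

theorem cast_refl {x y : X} (h h' : x = y) :
    (Path.Homotopic.Quotient.refl y).cast h h' = Path.Homotopic.Quotient.refl x := by
  subst h; simp

theorem mk_eq_mk_cast {x y x' y' : X} (p : Path x y) (q : Path x' y') (hx : x = x') (hy : y = y')
    (h : ∀ t, p t = q t) :
    Path.Homotopic.Quotient.mk p = (Path.Homotopic.Quotient.mk q).cast hx hy := by
  subst hx; subst hy
  rw [Path.Homotopic.Quotient.cast_rfl_rfl]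
  congr 1
  ext t
  exact h t

theorem translate_one {x y : X} (c : Path.Homotopic.Quotient x y) :
    translate (1 : G) c = c.cast (one_smul G x) (one_smul G y) := by
  induction c using Path.Homotopic.Quotient.ind with | mk c =>
  exact mk_eq_mk_cast _ _ _ _ fun t => one_smul G (c t)

theorem translate_mul {x y : X} (g g' : G) (c : Path.Homotopic.Quotient x y) :
    translate (g * g') c =
      (translate g (translate g' c)).cast (mul_smul g g' x) (mul_smul g g' y) := by
  induction c using Path.Homotopic.Quotient.ind with | mk c =>
  exact mk_eq_mk_cast _ _ _ _ fun t => mul_smul g g' (c t)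

/-- The product of `(g, c)` and `(g', c')` is `(g * g', c * (g • c'))`: run through `c`, then
through the translate of `c'` that starts at `g • x₀`. -/
instance : Mul (OrbifoldFundamentalGroup G x₀) where
  mul a b := ⟨a.elt * b.elt,
    (a.cls.trans (translate a.elt b.cls)).cast rfl (mul_smul a.elt b.elt x₀)⟩

instance : One (OrbifoldFundamentalGroup G x₀) where
  one := ⟨1, (Path.Homotopic.Quotient.refl x₀).cast rfl (one_smul G x₀)⟩

instance : Inv (OrbifoldFundamentalGroup G x₀) where
  inv a := ⟨a.elt⁻¹, (translate a.elt⁻¹ a.cls.symm).cast (inv_smul_smul a.elt x₀).symm rfl⟩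

theorem mul_def (a b : OrbifoldFundamentalGroup G x₀) : a * b = ⟨a.elt * b.elt,
    (a.cls.trans (translate a.elt b.cls)).cast rfl (mul_smul a.elt b.elt x₀)⟩ := rfl

theorem one_def : (1 : OrbifoldFundamentalGroup G x₀) =
    ⟨1, (Path.Homotopic.Quotient.refl x₀).cast rfl (one_smul G x₀)⟩ := rfl

theorem inv_def (a : OrbifoldFundamentalGroup G x₀) : a⁻¹ = ⟨a.elt⁻¹,
    (translate a.elt⁻¹ a.cls.symm).cast (inv_smul_smul a.elt x₀).symm rfl⟩ := rfl

instance : Group (OrbifoldFundamentalGroup G x₀) :=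
  Group.ofLeftAxioms
    (by
      rintro ⟨g, a⟩ ⟨h, b⟩ ⟨k, c⟩
      simp only [mul_def]
      refine mk_eq_mk (mul_assoc g h k) ?_
      rw [translate_cast, translate_trans, translate_mul, trans_cast, trans_cast]
      simp)
    (by
      rintro ⟨g, a⟩
      simp only [mul_def, one_def]
      refine mk_eq_mk (one_mul g) ?_
      rw [translate_one, trans_cast]
      simp)
    (by
      rintro ⟨g, a⟩
      simp only [mul_def, one_def, inv_def]
      refine mk_eq_mk (inv_mul_cancel g) ?_
      rw [cast_trans, Path.Homotopic.Quotient.cast_rfl_rfl, ← translate_trans,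
        Path.Homotopic.Quotient.symm_trans, translate_refl]
      simp only [Path.Homotopic.Quotient.cast_cast]
      rw [← cast_refl (inv_smul_smul g x₀).symm (inv_smul_smul g x₀).symm]
      simp only [Path.Homotopic.Quotient.cast_cast])

end OrbifoldFundamentalGroup

/-! ### Orbifold configuration spaces -/

/-- The group `Gⁿ ⋊ Sₙ`, where `(σ • f) i = f (σ⁻¹ i)`. -/
abbrev WreathSym (G : Type*) [Group G] (n : ℕ) : Type _ :=
  (Fin n → G) ⋊[(mulAutArrow : Equiv.Perm (Fin n) →* MulAut (Fin n → G))] Equiv.Perm (Fin n)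

/-- The space `Mⁿ ∖ Δₙᴳ(M)` of `n`-tuples of points of `M` in pairwise different `G`-orbits. -/
def OrbitConfiguration (G M : Type*) [Group G] [MulAction G M] (n : ℕ) : Type _ :=
  {x : Fin n → M // ∀ i j, i ≠ j → ∀ g : G, x i ≠ g • x j}

namespace OrbitConfiguration

variable {G M : Type*} [Group G] [MulAction G M] {n : ℕ}

instance [TopologicalSpace M] : TopologicalSpace (OrbitConfiguration G M n) :=
  instTopologicalSpaceSubtype

/-- `Gⁿ ⋊ Sₙ` acts on `n`-tuples by `((g, σ) • x) i = g i • x (σ⁻¹ i)`. -/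
instance : MulAction (WreathSym G n) (OrbitConfiguration G M n) where
  smul w x := ⟨fun i => w.left i • x.1 (w.right⁻¹ i), fun i j hij g h => by
    refine x.2 (w.right⁻¹ i) (w.right⁻¹ j) (fun e => hij (w.right⁻¹.injective e))
      ((w.left i)⁻¹ * g * w.left j) ?_
    rw [mul_smul, mul_smul, ← h, inv_smul_smul]⟩
  one_smul x := Subtype.ext (funext fun i => one_smul G (x.1 i))
  mul_smul w _ _ := Subtype.ext (funext fun i => mul_smul (w.left i) _ _)

theorem smul_val (w : WreathSym G n) (x : OrbitConfiguration G M n) (i : Fin n) :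
    (w • x).1 i = w.left i • x.1 (w.right⁻¹ i) := rfl

instance [TopologicalSpace M] [ContinuousConstSMul G M] :
    ContinuousConstSMul (WreathSym G n) (OrbitConfiguration G M n) where
  continuous_const_smul w := Continuous.subtype_mk
    (continuous_pi fun i => ((continuous_apply _).comp continuous_subtype_val).const_smul _) _

end OrbitConfiguration

/-- The orbifold braid group `Zₙ(M_G)` based at `x₀`: the orbifold fundamental group of the orbifold
configuration space `(Mⁿ ∖ Δₙᴳ(M))_{Gⁿ ⋊ Sₙ}`. -/
abbrev OrbifoldBraidGroup (G M : Type*) [Group G] [TopologicalSpace M] [MulAction G M]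
    [ContinuousConstSMul G M] (n : ℕ) (x₀ : OrbitConfiguration G M n) : Type _ :=
  OrbifoldFundamentalGroup (WreathSym G n) x₀

/-! ### The disk with one cone point -/

/-- The closed unit disk in `ℂ`. -/
abbrev ConeDisk : Type := Metric.closedBall (0 : ℂ) 1

/-- The group of `m`-th roots of unity (cyclic of order `m` for `m ≥ 1`) acts on the disk by
rotations around its center. -/
instance ConeDisk.instMulAction (m : ℕ) [NeZero m] : MulAction (rootsOfUnity m ℂ) ConeDisk where
  smul g z := ⟨((g : ℂˣ) : ℂ) * (z : ℂ), by
    have hz := z.2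
    rw [mem_closedBall_zero_iff] at hz ⊢
    rw [norm_mul, Complex.norm_eq_one_of_mem_rootsOfUnity g.2, one_mul]
    exact hz⟩
  one_smul z := Subtype.ext (one_mul (z : ℂ))
  mul_smul g h z := Subtype.ext (mul_assoc ((g : ℂˣ) : ℂ) ((h : ℂˣ) : ℂ) (z : ℂ))

theorem ConeDisk.smul_val (m : ℕ) [NeZero m] (g : rootsOfUnity m ℂ) (z : ConeDisk) :
    ((g • z : ConeDisk) : ℂ) = ((g : ℂˣ) : ℂ) * (z : ℂ) := rfl

instance ConeDisk.instContinuousConstSMul (m : ℕ) [NeZero m] :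
    ContinuousConstSMul (rootsOfUnity m ℂ) ConeDisk where
  continuous_const_smul _ := Continuous.subtype_mk (continuous_const.mul continuous_subtype_val) _

/-- The point `ρ * exp (i * φ)` of the disk. -/
def ConeDisk.polar (ρ φ : ℝ) (hρ : ρ ∈ I) : ConeDisk :=
  ⟨(ρ : ℂ) * Complex.exp ((φ : ℂ) * Complex.I), by
    rw [mem_closedBall_zero_iff, norm_mul, Complex.norm_exp_ofReal_mul_I, mul_one,
      Complex.norm_real, Real.norm_of_nonneg hρ.1]
    exact hρ.2⟩

theorem ConeDisk.norm_polar (ρ φ : ℝ) (hρ : ρ ∈ I) : ‖(ConeDisk.polar ρ φ hρ : ℂ)‖ = ρ := by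
  rw [ConeDisk.polar, norm_mul, Complex.norm_exp_ofReal_mul_I, mul_one,
    Complex.norm_real, Real.norm_of_nonneg hρ.1]

/-- Points of different absolute value lie in different orbits. -/
theorem ConeDisk.polar_ne_smul {m : ℕ} [NeZero m] {ρ φ ρ' φ' : ℝ} {hρ : ρ ∈ I} {hρ' : ρ' ∈ I}
    (h : ρ ≠ ρ') (g : rootsOfUnity m ℂ) :
    ConeDisk.polar ρ φ hρ ≠ g • ConeDisk.polar ρ' φ' hρ' := by
  intro e
  apply h
  have e' := congrArg (fun z : ConeDisk => ‖(z : ℂ)‖) e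
  simp only [ConeDisk.smul_val, norm_mul, Complex.norm_eq_one_of_mem_rootsOfUnity g.2, one_mul,
    ConeDisk.norm_polar] at e'
  exact e'

/-! ### The base point and the standard generators

Strands are numbered from `0`: strand `i : Fin n` is the strand number `i + 1` of the usual
numbering from `1`.  The strands start on the positive real axis, in order, so that strand `0` is
next to the cone point `0` of the disk. -/

/-- The starting point of strand `i` is the real number `(i + 1) / (n + 1)`. -/
def strandRadius (n : ℕ) (i : Fin n) : ℝ := ((i : ℝ) + 1) / ((n : ℝ) + 1)

theorem strandRadius_mem (n : ℕ) (i : Fin n) : strandRadius n i ∈ I := by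
  have h : ((i : ℕ) : ℝ) + 1 ≤ n := by exact_mod_cast i.2
  constructor
  · unfold strandRadius; positivity
  · unfold strandRadius; rw [div_le_one (by positivity)]; linarith

theorem strandRadius_injective (n : ℕ) : Function.Injective (strandRadius n) := by
  intro i j h
  unfold strandRadius at h
  have hn : ((n : ℝ) + 1) ≠ 0 := by positivity
  rw [div_left_inj' hn] at h
  have : ((i : ℕ) : ℝ) = (j : ℕ) := by linarith
  exact Fin.ext (by exact_mod_cast this)

/-- The base configuration. -/
def baseConfiguration (n m : ℕ) [NeZero m] : OrbitConfiguration (rootsOfUnity m ℂ) ConeDisk n :=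
  ⟨fun i => ConeDisk.polar (strandRadius n i) 0 (strandRadius_mem n i),
    fun _ _ hij g => ConeDisk.polar_ne_smul (fun h => hij (strandRadius_injective n h)) g⟩

/-- The orbifold braid group `Zₙ(D_{ℤ_m})`. -/
abbrev DiskBraidGroup (n m : ℕ) [NeZero m] : Type :=
  OrbifoldBraidGroup (rootsOfUnity m ℂ) ConeDisk n (baseConfiguration n m)

/-- The root of unity `exp (2πi / m)`, a generator of the acting group. -/
def rotGen (m : ℕ) [NeZero m] : rootsOfUnity m ℂ :=
  (Complex.isPrimitiveRoot_exp m (NeZero.ne m)).toRootsOfUnity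

theorem rotGen_val (m : ℕ) [NeZero m] : (((rotGen m : rootsOfUnity m ℂ) : ℂˣ) : ℂ) =
    Complex.exp (2 * Real.pi * Complex.I / m) := rfl

/-- The group element of the generator `u`: rotate strand `0` by `2π / m`. -/
def uElt (n m : ℕ) [NeZero m] : WreathSym (rootsOfUnity m ℂ) n :=
  ⟨fun i => if (i : ℕ) = 0 then rotGen m else 1, 1⟩

/-- The path of the generator `u`: strand `0` turns counterclockwise around the cone point by the
angle `2π / m`, all other strands are constant.  In the quotient, it encircles the cone point
once. -/
def uPath (n m : ℕ) [NeZero m] :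
    Path (baseConfiguration n m) (uElt n m • baseConfiguration n m) where
  toFun t := ⟨fun i => ConeDisk.polar (strandRadius n i)
      (if (i : ℕ) = 0 then 2 * Real.pi / m * (t : ℝ) else 0) (strandRadius_mem n i),
    fun _ _ hij g => ConeDisk.polar_ne_smul (fun h => hij (strandRadius_injective n h)) g⟩
  continuous_toFun := by
    refine Continuous.subtype_mk (continuous_pi fun i => Continuous.subtype_mk ?_ _) _
    split_ifs <;> fun_prop
  source' := by
    refine Subtype.ext (funext fun i => Subtype.ext ?_)
    simp [baseConfiguration, ConeDisk.polar]
  target' := by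
    refine Subtype.ext (funext fun i => Subtype.ext ?_)
    rw [OrbitConfiguration.smul_val, ConeDisk.smul_val]
    by_cases h : (i : ℕ) = 0
    · simp only [baseConfiguration, ConeDisk.polar, uElt, h, if_true, rotGen_val]
      push_cast
      simp only [inv_one, Equiv.Perm.coe_one, id_eq, zero_mul, Complex.exp_zero, mul_one]
      rw [mul_comm]
      congr 2
      ring
    · simp [baseConfiguration, ConeDisk.polar, uElt, h]

/-- The generator `u`. -/
def uBraid (n m : ℕ) [NeZero m] : DiskBraidGroup n m :=
  OrbifoldFundamentalGroup.ofPath (uElt n m) (uPath n m)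

/-- The distance from the center of strand `i` at time `t` in the half twist of the strands `j`
and `j + 1`, which changes places of these strands: it goes from `(j + 1) / (n + 1)` to
`(j + 2) / (n + 1)` on strand `j`, and back on strand `j + 1`. -/
def twistRadius (n j : ℕ) (t : ℝ) (i : Fin n) : ℝ :=
  if (i : ℕ) = j then ((j : ℝ) + 3 / 2 - Real.cos (Real.pi * t) / 2) / ((n : ℝ) + 1)
  else if (i : ℕ) = j + 1 then ((j : ℝ) + 3 / 2 + Real.cos (Real.pi * t) / 2) / ((n : ℝ) + 1)
  else strandRadius n i

/-- The angle of strand `i` at time `t` in the half twist of the strands `j` and `j + 1`.  All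
angles lie between `-π / (2m)` and `π / (2m)`, so the half twist takes place inside a fundamental
domain for the rotations.  It is counterclockwise: the outer strand `j + 1` moves inwards through
positive angles, the inner strand `j` moves outwards through negative angles. -/
def twistAngle (n m j : ℕ) (t : ℝ) (i : Fin n) : ℝ :=
  if (i : ℕ) = j then -(Real.pi / (2 * m) * Real.sin (Real.pi * t))
  else if (i : ℕ) = j + 1 then Real.pi / (2 * m) * Real.sin (Real.pi * t)
  else 0

theorem twistRadius_mem {n j : ℕ} (hj : j + 1 < n) (t : ℝ) (i : Fin n) :
    twistRadius n j t i ∈ I := by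
  have h : (j : ℝ) + 2 ≤ n := by exact_mod_cast hj
  have h1 := Real.cos_le_one (Real.pi * t)
  have h2 := Real.neg_one_le_cos (Real.pi * t)
  have hj0 : (0 : ℝ) ≤ j := Nat.cast_nonneg j
  have hn : (0 : ℝ) < (n : ℝ) + 1 := by positivity
  unfold twistRadius
  split_ifs
  · exact ⟨div_nonneg (by linarith) hn.le, (div_le_one hn).2 (by linarith)⟩
  · exact ⟨div_nonneg (by linarith) hn.le, (div_le_one hn).2 (by linarith)⟩
  · exact strandRadius_mem n i

/-- During the half twist, two strands are at the same distance from the center only if they are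
the two moving strands, halfway. -/
theorem twistRadius_eq {n j : ℕ} {t : ℝ} {a b : Fin n} (hab : (a : ℕ) < b)
    (h : twistRadius n j t a = twistRadius n j t b) :
    (a : ℕ) = j ∧ (b : ℕ) = j + 1 ∧ Real.cos (Real.pi * t) = 0 := by
  have h1 := Real.cos_le_one (Real.pi * t)
  have h2 := Real.neg_one_le_cos (Real.pi * t)
  have hn : ((n : ℝ) + 1) ≠ 0 := by positivity
  have key : ∀ p q : ℕ, p < q → (p : ℝ) + 1 ≤ q := fun p q hpq => by exact_mod_cast hpq
  have kab := key _ _ hab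
  unfold twistRadius strandRadius at h
  split_ifs at h with ha hb hb ha' hb hb hb hb' <;> rw [div_left_inj' hn] at h
  · omega
  · exact ⟨ha, hb, by linarith⟩
  · have := key (j + 1) b (by omega)
    push_cast at this
    linarith
  · omega
  · omega
  · have := key (j + 1) b (by omega)
    push_cast at this
    linarith
  · have := key a j (by omega)
    linarith
  · have := key a j (by omega)
    linarith
  · linarith

theorem twist_ne {n m j : ℕ} [NeZero m] (hj : j + 1 < n) (t : ℝ) {a b : Fin n}
    (hab : (a : ℕ) < b) (g : rootsOfUnity m ℂ) :
    ConeDisk.polar (twistRadius n j t a) (twistAngle n m j t a) (twistRadius_mem hj t a) ≠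
      g • ConeDisk.polar (twistRadius n j t b) (twistAngle n m j t b) (twistRadius_mem hj t b) := by
  by_cases hr : twistRadius n j t a = twistRadius n j t b
  swap
  · exact ConeDisk.polar_ne_smul hr g
  obtain ⟨ha, hb, hc⟩ := twistRadius_eq hab hr
  intro e
  have e1 : (twistRadius n j t a : ℂ) * Complex.exp ((twistAngle n m j t a : ℂ) * Complex.I) =
      ((g : ℂˣ) : ℂ) * ((twistRadius n j t b : ℂ) *
        Complex.exp ((twistAngle n m j t b : ℂ) * Complex.I)) := congrArg Subtype.val e
  have hR : twistRadius n j t b ≠ 0 := by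
    have : twistRadius n j t b = ((j : ℝ) + 3 / 2) / ((n : ℝ) + 1) := by
      simp [twistRadius, hb, hc]
    rw [this]
    positivity
  have hRC : (twistRadius n j t b : ℂ) ≠ 0 := by exact_mod_cast hR
  rw [hr, mul_left_comm] at e1
  have e2 := congrArg (fun z : ℂ => z ^ m) (mul_left_cancel₀ hRC e1)
  have hg : (((g : ℂˣ) : ℂ)) ^ m = 1 := by
    have := congrArg Units.val ((mem_rootsOfUnity m (g : ℂˣ)).1 g.2)
    rwa [Units.val_pow_eq_pow_val, Units.val_one] at this
  simp only [mul_pow, hg, one_mul, ← Complex.exp_nat_mul] at e2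
  have hm : (m : ℂ) ≠ 0 := by exact_mod_cast NeZero.ne m
  have hA : (m : ℂ) * ((twistAngle n m j t a : ℂ) * Complex.I) =
      -((Real.pi / 2 * Real.sin (Real.pi * t) : ℝ) : ℂ) * Complex.I := by
    simp only [twistAngle, ha, if_true]
    push_cast
    field_simp
  have hB : (m : ℂ) * ((twistAngle n m j t b : ℂ) * Complex.I) =
      ((Real.pi / 2 * Real.sin (Real.pi * t) : ℝ) : ℂ) * Complex.I := by
    have : ¬ ((b : ℕ) = j) := by omega
    simp only [twistAngle, hb, Nat.succ_ne_self, if_true, if_false]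
    push_cast
    field_simp
  rw [hA, hB] at e2
  have him := congrArg Complex.im e2
  rw [← Complex.ofReal_neg, Complex.exp_ofReal_mul_I_im, Complex.exp_ofReal_mul_I_im,
    Real.sin_neg] at him
  have hs : Real.sin (Real.pi * t) = 1 ∨ Real.sin (Real.pi * t) = -1 := by
    have := Real.sin_sq_add_cos_sq (Real.pi * t)
    rw [hc] at this
    exact sq_eq_one_iff.1 (by linarith)
  rcases hs with hs | hs
  · rw [hs, mul_one, Real.sin_pi_div_two] at him
    linarith
  · rw [hs, mul_neg_one, Real.sin_neg, Real.sin_pi_div_two] at him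
    linarith

/-- The group element of the half twist: the transposition of the strands `j` and `j + 1`. -/
def hElt (n m j : ℕ) (hj : j + 1 < n) : WreathSym (rootsOfUnity m ℂ) n :=
  ⟨1, Equiv.swap ⟨j, Nat.lt_of_succ_lt hj⟩ ⟨j + 1, hj⟩⟩

/-- The path of the half twist of the strands `j` and `j + 1`; all other strands are constant. -/
def hPath (n m j : ℕ) [NeZero m] (hj : j + 1 < n) :
    Path (baseConfiguration n m) (hElt n m j hj • baseConfiguration n m) where
  toFun t := ⟨fun i => ConeDisk.polar (twistRadius n j t i) (twistAngle n m j t i)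
      (twistRadius_mem hj t i), fun a b hab g => by
    rcases lt_or_gt_of_ne (fun h => hab (Fin.ext h) : (a : ℕ) ≠ b) with h | h
    · exact twist_ne hj t h g
    · intro e
      refine twist_ne hj t h g⁻¹ ?_
      exact (inv_smul_eq_iff.2 e).symm⟩
  continuous_toFun := by
    refine Continuous.subtype_mk (continuous_pi fun i => Continuous.subtype_mk ?_ _) _
    simp only [twistRadius, twistAngle]
    split_ifs <;> fun_prop
  source' := by
    refine Subtype.ext (funext fun i => Subtype.ext ?_)
    simp only [baseConfiguration, ConeDisk.polar, twistRadius, twistAngle, strandRadius]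
    split_ifs with h h'
    · simp [h]; ring
    · simp [h']; ring
    · simp
  target' := by
    refine Subtype.ext (funext fun i => Subtype.ext ?_)
    rw [OrbitConfiguration.smul_val, ConeDisk.smul_val]
    simp only [baseConfiguration, ConeDisk.polar, twistRadius, twistAngle, strandRadius, hElt]
    split_ifs with h h'
    · have : i = ⟨j, Nat.lt_of_succ_lt hj⟩ := Fin.ext h
      subst this
      simp; ring
    · have : i = ⟨j + 1, hj⟩ := Fin.ext h'
      subst this
      simp; ring
    · have h1 : i ≠ ⟨j, Nat.lt_of_succ_lt hj⟩ := fun e => h (congrArg Fin.val e)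
      have h2 : i ≠ ⟨j + 1, hj⟩ := fun e => h' (congrArg Fin.val e)
      simp [Equiv.swap_apply_of_ne_of_ne h1 h2]

/-- The generator which is the half twist of the strands `j` and `j + 1`; it is `h_{j+1}` in the
usual numbering from `1`. -/
def hBraid (n m j : ℕ) [NeZero m] (hj : j + 1 < n) : DiskBraidGroup n m :=
  OrbifoldFundamentalGroup.ofPath (hElt n m j hj) (hPath n m j hj)

/-- `gammaBraid n m k` is, in the usual numbering from `1`, the element
`γ_{k+1} = h_k ⋯ h_1 u h_1 ⋯ h_k`. -/
def gammaBraid (n m : ℕ) [NeZero m] (k : Fin n) : DiskBraidGroup n m :=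
  (List.ofFn fun i : Fin k => hBraid n m i (by omega)).reverse.prod * uBraid n m *
    (List.ofFn fun i : Fin k => hBraid n m i (by omega)).prod

/-- The element `θ_n = γ_n γ_{n-1} ⋯ γ_1`. -/
def thetaBraid (n m : ℕ) [NeZero m] : DiskBraidGroup n m :=
  (List.ofFn fun k : Fin n => gammaBraid n m k).reverse.prod

end

open scoped unitInterval

noncomputable section

/-! The heart of the proof is that `θ_n` is the rigid rotation of all strands by `2π/m`. The braids
in which every strand keeps its distance from the cone point and strand `i` turns by `2π e i / m`
multiply by adding the exponents (`rotBraid_mul`), and `u` is the turn of strand `0`. The inductive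
step is `hBraid_mul_rotBraid_mul_hBraid`: conjugating by a half twist (with `h` on both sides, not
`h⁻¹`) makes a turn of strand `k` a turn of strand `k + 1`. Strand `k + 1` goes inwards, turns once
around the cone point, and goes back out through the same gap between strand `k` and its next
rotated image, so the turn can be pulled outside strand `k`. Hence every `γ_j` is the turn of one
strand, and their product turns all strands once (`thetaBraid_eq_rotBraid`).

These homotopies are found in polar coordinates. There the paths to be compared lie in a common star
convex set of coordinates of genuine configurations, so they are homotopic without an explicit
formula (`homotopic_of_polarLift`).

Centrality holds because rotating a whole configuration commutes with running along a path: `(s, t)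
↦ exp(2πis/m) p(t)` fills the square between the two products (`rotBraid_one_mul_comm`).

For infinite order, `x_i ^ m - x_j ^ m` never vanishes, and its argument changes by `2πk` along the
`k`-th power of the rotation. This change is a homotopy invariant, by monodromy of the covering
`Circle.exp`, and needs two strands to exist. -/

/-! ### Homotopies from lifts, and products of `G`-loops. -/

/-- Two paths which lift to paths with common end points in a simply connected space are
homotopic. -/
theorem Path.Homotopic.of_lift {X Y : Type*} [TopologicalSpace X] [TopologicalSpace Y]
    [SimplyConnectedSpace Y] {F : Y → X} (hF : Continuous F) {a b : Y} (α β : Path a b) {x y : X}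
    {p q : Path x y} (hp : ∀ t, p t = F (α t)) (hq : ∀ t, q t = F (β t)) : p.Homotopic q := by
  have hx : x = F a := by rw [← p.source, hp, α.source]
  have hy : y = F b := by rw [← p.target, hp, α.target]
  subst hx hy
  have h := (SimplyConnectedSpace.paths_homotopic α β).map ⟨F, hF⟩
  have e1 : p = α.map hF := Path.ext (funext hp)
  have e2 : q = β.map hF := Path.ext (funext hq)
  rw [e1, e2]
  exact h

namespace OrbifoldFundamentalGroup

variable {G X : Type*} [Group G] [TopologicalSpace X] [MulAction G X] {x₀ : X}

theorem ofPath_eq_ofPath {g g' : G} (h : g = g') {p : Path x₀ (g • x₀)} {p' : Path x₀ (g' • x₀)}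
    (H : p.Homotopic (p'.cast rfl (by rw [h]))) : ofPath g p = ofPath g' p' := by
  subst h
  exact congrArg (OrbifoldFundamentalGroup.mk g) (Path.Homotopic.Quotient.eq.2 H)

theorem ofPath_mul_ofPath [ContinuousConstSMul G X] (g g' : G) (p : Path x₀ (g • x₀))
    (p' : Path x₀ (g' • x₀)) : ofPath g p * ofPath g' p' = ofPath (g * g')
      ((p.trans (p'.map (continuous_const_smul g))).cast rfl (mul_smul g g' x₀)) := rfl

end OrbifoldFundamentalGroup

open OrbifoldFundamentalGroup

variable {n m : ℕ}

/-! ### Polar coordinates -/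

/-- `v` is a system of polar coordinates (radius and angle) of the configuration `x`. -/
def IsPolarLift [NeZero m] (x : OrbitConfiguration (rootsOfUnity m ℂ) ConeDisk n)
    (v : Fin n → ℝ × ℝ) : Prop :=
  ∀ i, (x.1 i : ℂ) = ((v i).1 : ℂ) * Complex.exp (((v i).2 : ℂ) * Complex.I)

/-- Polar coordinates of configurations in which any two strands at the same distance from the
center have angles differing by less than `2π / m`, the strand with the larger number having the
larger angle. -/
def polarRegion (n m : ℕ) : Set (Fin n → ℝ × ℝ) :=
  {v | (∀ i, (v i).1 ∈ I) ∧ ∀ i j, i < j → (v i).1 = (v j).1 →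
    0 < (v i).1 ∧ 0 < (v j).2 - (v i).2 ∧ (v j).2 - (v i).2 < 2 * Real.pi / m}

/-- Raising to the `m`-th power removes the root of unity. At equal positive radii, a common orbit
would make `m` times the difference of angles a multiple of `2π`, but it lies strictly between `0`
and `2π`. -/
theorem polar_ne_smul_of_lt [NeZero m] {v : Fin n → ℝ × ℝ} (hv : v ∈ polarRegion n m) {i j : Fin n}
    (hij : i < j) (g : rootsOfUnity m ℂ) :
    ConeDisk.polar (v i).1 (v i).2 (hv.1 i) ≠ g • ConeDisk.polar (v j).1 (v j).2 (hv.1 j) := by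
  by_cases hr : (v i).1 = (v j).1
  swap
  · exact ConeDisk.polar_ne_smul hr g
  obtain ⟨h0, h1, h2⟩ := hv.2 i j hij hr
  intro e
  have e1 : ((v i).1 : ℂ) * Complex.exp (((v i).2 : ℂ) * Complex.I) =
      ((g : ℂˣ) : ℂ) * (((v j).1 : ℂ) * Complex.exp (((v j).2 : ℂ) * Complex.I)) :=
    congrArg Subtype.val e
  have hRC : ((v i).1 : ℂ) ≠ 0 := by exact_mod_cast h0.ne'
  rw [← hr, mul_left_comm] at e1
  have e2 := congrArg (fun z : ℂ => z ^ m) (mul_left_cancel₀ hRC e1)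
  have hg : (((g : ℂˣ) : ℂ)) ^ m = 1 := by
    have := congrArg Units.val ((mem_rootsOfUnity m (g : ℂˣ)).1 g.2)
    rwa [Units.val_pow_eq_pow_val, Units.val_one] at this
  simp only [mul_pow, hg, one_mul, ← Complex.exp_nat_mul] at e2
  obtain ⟨k, hk⟩ := Complex.exp_eq_exp_iff_exists_int.1 e2.symm
  have hk' : (m : ℝ) * ((v j).2 - (v i).2) = k * (2 * Real.pi) := by
    have := congrArg Complex.im hk
    simp at this
    linarith
  have hm : (0 : ℝ) < m := by exact_mod_cast Nat.pos_of_ne_zero (NeZero.ne m)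
  rw [lt_div_iff₀ hm] at h2
  have hpi := Real.pi_pos
  have k0 : (0 : ℝ) < k := by
    have := mul_pos hm h1
    by_contra hc
    nlinarith
  have k1 : (k : ℝ) < 1 := by
    by_contra hc
    nlinarith
  have k0' : (0 : ℤ) < k := by exact_mod_cast k0
  have k1' : k < (1 : ℤ) := by exact_mod_cast k1
  omega

/-- The configuration with given polar coordinates. -/
def ofPolar [NeZero m] (v : polarRegion n m) : OrbitConfiguration (rootsOfUnity m ℂ) ConeDisk n :=
  ⟨fun i => ConeDisk.polar (v.1 i).1 (v.1 i).2 (v.2.1 i), fun i j hij g => by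
    rcases lt_or_gt_of_ne hij with h | h
    · exact polar_ne_smul_of_lt v.2 h g
    · intro e
      refine polar_ne_smul_of_lt v.2 h g⁻¹ ?_
      exact (inv_smul_eq_iff.2 e).symm⟩

theorem continuous_ofPolar [NeZero m] :
    Continuous (ofPolar : polarRegion n m → OrbitConfiguration (rootsOfUnity m ℂ) ConeDisk n) := by
  refine Continuous.subtype_mk (continuous_pi fun i => Continuous.subtype_mk ?_ _) _
  have h : Continuous fun v : polarRegion n m => v.1 i :=
    (continuous_apply i).comp continuous_subtype_val
  have h1 := h.fst
  have h2 := h.snd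
  fun_prop

theorem IsPolarLift.eq_ofPolar [NeZero m] {x : OrbitConfiguration (rootsOfUnity m ℂ) ConeDisk n}
    {v : Fin n → ℝ × ℝ} (h : IsPolarLift x v) (hv : v ∈ polarRegion n m) : x = ofPolar ⟨v, hv⟩ :=
  Subtype.ext (funext fun i => Subtype.ext (h i))

/-- Paths of configurations are homotopic if they can be written in polar coordinates inside a
star convex set. -/
theorem homotopic_of_polarLift [NeZero m] {V : Set (Fin n → ℝ × ℝ)} {c : Fin n → ℝ × ℝ}
    (hV : StarConvex ℝ c V) (hsub : V ⊆ polarRegion n m)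
    {x y : OrbitConfiguration (rootsOfUnity m ℂ) ConeDisk n} {p q : Path x y}
    {a b : Fin n → ℝ × ℝ} (α β : Path a b) (hα : ∀ t, α t ∈ V) (hβ : ∀ t, β t ∈ V)
    (hp : ∀ t, IsPolarLift (p t) (α t)) (hq : ∀ t, IsPolarLift (q t) (β t)) : p.Homotopic q := by
  have ha : a ∈ V := α.source ▸ hα 0
  have hb : b ∈ V := α.target ▸ hα 1
  have : ContractibleSpace V := hV.contractibleSpace ⟨a, ha⟩
  let lift (γ : Path a b) (hγ : ∀ t, γ t ∈ V) : Path (⟨a, ha⟩ : V) ⟨b, hb⟩ :=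
    { toFun := fun t => ⟨γ t, hγ t⟩
      continuous_toFun := Continuous.subtype_mk γ.continuous _
      source' := Subtype.ext γ.source
      target' := Subtype.ext γ.target }
  exact Path.Homotopic.of_lift (F := fun v : V => ofPolar ⟨v.1, hsub v.2⟩)
    (continuous_ofPolar.comp (Continuous.subtype_mk continuous_subtype_val _))
    (lift α hα) (lift β hβ) (fun t => (hp t).eq_ofPolar _) (fun t => (hq t).eq_ofPolar _)

/-! ### Braids represented by paths of polar coordinates. -/

/-- The polar coordinates of the base configuration. -/
def basePolar (n : ℕ) : Fin n → ℝ × ℝ := fun i => (strandRadius n i, 0)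

/-- The path `α` in polar coordinates represents the braid `a`. -/
def PolarRep [NeZero m] (a : DiskBraidGroup n m) {v : Fin n → ℝ × ℝ} (α : Path (basePolar n) v) :
    Prop :=
  ∃ p : Path (baseConfiguration n m) (a.elt • baseConfiguration n m),
    a = ofPath a.elt p ∧ ∀ t, IsPolarLift (p t) (α t)

/-- The second factor is run through after translation by the group element of the first, so `γ` has
to lift the translated path. Only the exponentials of the angles are prescribed: the branch of each
angle is free, and is fixed by the requirement that `γ` starts where `α` ends. -/
theorem PolarRep.mul [NeZero m] {a b : DiskBraidGroup n m} {v w v' : Fin n → ℝ × ℝ}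
    {α : Path (basePolar n) v} {β : Path (basePolar n) w} (ha : PolarRep a α) (hb : PolarRep b β)
    (γ : Path v v') (hγ : ∀ t i, (γ t i).1 = (β t (a.elt.right⁻¹ i)).1 ∧
      Complex.exp (((γ t i).2 : ℂ) * Complex.I) = (((a.elt.left i : rootsOfUnity m ℂ) : ℂˣ) : ℂ) *
        Complex.exp (((β t (a.elt.right⁻¹ i)).2 : ℂ) * Complex.I)) :
    PolarRep (a * b) (α.trans γ) := by
  obtain ⟨p, hp, hpα⟩ := ha
  obtain ⟨q, hq, hqβ⟩ := hb
  refine ⟨(p.trans (q.map (continuous_const_smul a.elt))).cast rfl (mul_smul a.elt b.elt _), ?_, ?_⟩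
  · conv_lhs => rw [hp, hq]
    rfl
  · intro t
    rw [Path.cast_coe, Path.trans_apply, Path.trans_apply]
    split_ifs with h
    · exact hpα _
    · intro i
      rw [Path.map_coe, Function.comp_apply, OrbitConfiguration.smul_val, ConeDisk.smul_val,
        hqβ _ _, (hγ _ i).1, (hγ _ i).2]
      ring

theorem PolarRep.eq [NeZero m] {a b : DiskBraidGroup n m} {v w : Fin n → ℝ × ℝ}
    {α : Path (basePolar n) v} {β : Path (basePolar n) w} (ha : PolarRep a α) (hb : PolarRep b β)
    (hab : a.elt = b.elt) (hvw : v = w) {V : Set (Fin n → ℝ × ℝ)} {c : Fin n → ℝ × ℝ}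
    (hV : StarConvex ℝ c V) (hsub : V ⊆ polarRegion n m)
    (hα : ∀ t, α t ∈ V) (hβ : ∀ t, β t ∈ V) : a = b := by
  subst hvw
  obtain ⟨p, hp, hpα⟩ := ha
  obtain ⟨q, hq, hqβ⟩ := hb
  rw [hp, hq]
  exact ofPath_eq_ofPath hab (homotopic_of_polarLift hV hsub α β hα hβ hpα hqβ)

theorem Path.trans_mem {X : Type*} [TopologicalSpace X] {x y z : X} {α : Path x y} {β : Path y z}
    {V : Set X} (hα : ∀ t, α t ∈ V) (hβ : ∀ t, β t ∈ V) (t : I) : α.trans β t ∈ V := by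
  rw [Path.trans_apply]
  split_ifs
  · exact hα _
  · exact hβ _

/-! ### Rotations of single strands -/

theorem rotGen_pow_val (m : ℕ) [NeZero m] (k : ℕ) :
    (((rotGen m ^ k : rootsOfUnity m ℂ) : ℂˣ) : ℂ) =
      Complex.exp (((2 * Real.pi / m * k : ℝ) : ℂ) * Complex.I) := by
  rw [SubmonoidClass.coe_pow, Units.val_pow_eq_pow_val, rotGen_val, ← Complex.exp_nat_mul]
  congr 1
  push_cast
  ring

/-- The group element which rotates strand `i` by `2π e i / m`. -/
def rotElt (m : ℕ) [NeZero m] (e : Fin n → ℕ) : WreathSym (rootsOfUnity m ℂ) n :=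
  ⟨fun i => rotGen m ^ e i, 1⟩

/-- The path in polar coordinates along which strand `i` turns by `2π e i / m`. -/
def rotPolarPath (m : ℕ) (e : Fin n → ℕ) :
    Path (basePolar n) (fun i => (strandRadius n i, 2 * Real.pi / m * e i)) where
  toFun t i := (strandRadius n i, 2 * Real.pi / m * e i * (t : ℝ))
  continuous_toFun := by fun_prop
  source' := by funext i; simp [basePolar]
  target' := by funext i; simp

/-- The path along which strand `i` turns by `2π e i / m`. -/
def rotPath (m : ℕ) [NeZero m] (e : Fin n → ℕ) :
    Path (baseConfiguration n m) (rotElt m e • baseConfiguration n m) where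
  toFun t := ⟨fun i => ConeDisk.polar (strandRadius n i) (2 * Real.pi / m * e i * (t : ℝ))
      (strandRadius_mem n i),
    fun _ _ hij g => ConeDisk.polar_ne_smul (fun h => hij (strandRadius_injective n h)) g⟩
  continuous_toFun := by
    refine Continuous.subtype_mk (continuous_pi fun i => Continuous.subtype_mk ?_ _) _
    fun_prop
  source' := by
    refine Subtype.ext (funext fun i => Subtype.ext ?_)
    simp [baseConfiguration, ConeDisk.polar]
  target' := by
    refine Subtype.ext (funext fun i => Subtype.ext ?_)
    rw [OrbitConfiguration.smul_val, ConeDisk.smul_val]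
    simp only [rotElt, rotGen_pow_val, baseConfiguration, ConeDisk.polar, Set.Icc.coe_one, mul_one,
      inv_one, Equiv.Perm.coe_one, id_eq, Complex.ofReal_zero, zero_mul, Complex.exp_zero]
    ring

/-- The braid in which strand `i` turns by `2π e i / m` around the cone point. -/
def rotBraid (m : ℕ) [NeZero m] (e : Fin n → ℕ) : DiskBraidGroup n m :=
  ofPath (rotElt m e) (rotPath m e)

theorem rotBraid_polarRep (m : ℕ) [NeZero m] (e : Fin n → ℕ) :
    PolarRep (rotBraid m e) (rotPolarPath m e) :=
  ⟨rotPath m e, rfl, fun _ _ => rfl⟩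

/-- The polar coordinates in which every strand keeps its distance from the center. -/
def radialFiber (n : ℕ) : Set (Fin n → ℝ × ℝ) := {v | ∀ i, (v i).1 = strandRadius n i}

theorem starConvex_radialFiber (n : ℕ) : StarConvex ℝ (basePolar n) (radialFiber n) := by
  intro v hv a b _ _ hab i
  simp only [Pi.add_apply, Pi.smul_apply, Prod.fst_add, Prod.smul_fst, hv i, basePolar, smul_eq_mul]
  rw [← add_mul, hab, one_mul]

/-- Since the base radii are distinct, the condition on strands at equal distance is vacuous. -/
theorem radialFiber_subset (n m : ℕ) : radialFiber n ⊆ polarRegion n m := by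
  refine fun v hv => ⟨fun i => hv i ▸ strandRadius_mem n i, fun i j hij h => ?_⟩
  rw [hv i, hv j] at h
  exact absurd (strandRadius_injective n h) hij.ne

theorem rotBraid_mul (m : ℕ) [NeZero m] (e f : Fin n → ℕ) :
    rotBraid m e * rotBraid m f = rotBraid m (e + f) := by
  let γ : Path (fun i => (strandRadius n i, 2 * Real.pi / m * e i))
      (fun i => (strandRadius n i, 2 * Real.pi / m * (e + f) i)) :=
    { toFun := fun t i => (strandRadius n i, 2 * Real.pi / m * e i + 2 * Real.pi / m * f i * (t : ℝ))
      continuous_toFun := by fun_prop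
      source' := by funext i; simp
      target' := by funext i; simp [mul_add] }
  have h := (rotBraid_polarRep m e).mul (rotBraid_polarRep m f) γ (fun t i => ⟨rfl, by
    change Complex.exp (((2 * Real.pi / m * e i + 2 * Real.pi / m * f i * (t : ℝ) : ℝ) : ℂ) *
      Complex.I) = (((rotGen m ^ e i : rootsOfUnity m ℂ) : ℂˣ) : ℂ) *
      Complex.exp (((2 * Real.pi / m * f i * (t : ℝ) : ℝ) : ℂ) * Complex.I)
    rw [rotGen_pow_val, ← Complex.exp_add]
    push_cast
    congr 1
    ring⟩)
  refine h.eq (rotBraid_polarRep m (e + f)) ?_ rfl (starConvex_radialFiber n)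
    (radialFiber_subset n m) (Path.trans_mem (fun _ _ => rfl) (fun _ _ => rfl)) (fun _ _ => rfl)
  refine SemidirectProduct.ext (funext fun i => ?_) rfl
  exact (pow_add (rotGen m) (e i) (f i)).symm

theorem rotBraid_zero (m : ℕ) [NeZero m] : rotBraid m (0 : Fin n → ℕ) = 1 := by
  have h := rotBraid_mul m (0 : Fin n → ℕ) 0
  rw [add_zero] at h
  -- An idempotent of a group is trivial, so no separate homotopy is needed.
  exact mul_eq_left.1 h

/-- `rotBraid` as a homomorphism. -/
def rotHom (n m : ℕ) [NeZero m] : Multiplicative (Fin n → ℕ) →* DiskBraidGroup n m where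
  toFun e := rotBraid m e.toAdd
  map_one' := rotBraid_zero m
  map_mul' e f := (rotBraid_mul m e.toAdd f.toAdd).symm

theorem uBraid_eq_rotBraid (m : ℕ) [NeZero m] (hn : 0 < n) :
    uBraid n m = rotBraid m (Pi.single ⟨0, hn⟩ 1) := by
  have hs : ∀ i : Fin n, (Pi.single ⟨0, hn⟩ 1 : Fin n → ℕ) i = if (i : ℕ) = 0 then 1 else 0 := by
    intro i
    simp [Pi.single_apply, Fin.ext_iff]
  have helt : uElt n m = rotElt m (Pi.single ⟨0, hn⟩ 1) := by
    refine SemidirectProduct.ext (funext fun i => ?_) rfl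
    simp only [uElt, rotElt, hs]
    split_ifs <;> simp
  refine ofPath_eq_ofPath helt ?_
  have : uPath n m = (rotPath m (Pi.single ⟨0, hn⟩ 1)).cast rfl (by rw [helt]) := by
    ext t
    refine Subtype.ext (funext fun i => Subtype.ext ?_)
    simp only [Path.cast_coe]
    change (strandRadius n i : ℂ) *
      Complex.exp (((if (i : ℕ) = 0 then 2 * Real.pi / m * (t : ℝ) else 0 : ℝ) : ℂ) * Complex.I) =
      (strandRadius n i : ℂ) * Complex.exp (((2 * Real.pi / m *
        (Pi.single ⟨0, hn⟩ 1 : Fin n → ℕ) i * (t : ℝ) : ℝ) : ℂ) * Complex.I)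
    rw [hs]
    split_ifs <;> simp
  rw [this]

/-! ### Conjugation of rotations by half twists -/

theorem strandRadius_strictMono (n : ℕ) : StrictMono (strandRadius n) := by
  intro i j h
  have hn : (0 : ℝ) < (n : ℝ) + 1 := by positivity
  have h' : ((i : ℕ) : ℝ) < (j : ℕ) := by exact_mod_cast h
  unfold strandRadius
  rw [div_lt_div_iff_of_pos_right hn]
  linarith

theorem strandRadius_pos (n : ℕ) (i : Fin n) : 0 < strandRadius n i := by
  unfold strandRadius
  positivity

/-- The polar coordinates `x` and `y` for the strands `k` and `k + 1`, and those of the base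
configuration for the others. -/
def pairPolar (n k : ℕ) (x y : ℝ × ℝ) : Fin n → ℝ × ℝ := fun i =>
  if (i : ℕ) = k then x else if (i : ℕ) = k + 1 then y else (strandRadius n i, 0)

theorem continuous_pairPolar {k : ℕ} {X : Type*} [TopologicalSpace X] {f g : X → ℝ × ℝ}
    (hf : Continuous f) (hg : Continuous g) :
    Continuous fun t => pairPolar n k (f t) (g t) := by
  refine continuous_pi fun i => ?_
  unfold pairPolar
  split_ifs
  · exact hf
  · exact hg
  · exact continuous_const

/-- Applied to `rfl`, this reads off all coordinates at once; from right to left it recognises a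
given tuple. -/
theorem pairPolar_eq_iff {k : ℕ} (hk : k + 1 < n) {x y : ℝ × ℝ} {v : Fin n → ℝ × ℝ} :
    v = pairPolar n k x y ↔ v ⟨k, Nat.lt_of_succ_lt hk⟩ = x ∧ v ⟨k + 1, hk⟩ = y ∧
      ∀ i : Fin n, (i : ℕ) ≠ k → (i : ℕ) ≠ k + 1 → v i = (strandRadius n i, 0) := by
  constructor
  · rintro rfl
    refine ⟨by simp [pairPolar], by simp [pairPolar], fun i h h' => by simp [pairPolar, h, h']⟩
  · rintro ⟨hx, hy, h⟩
    funext i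
    unfold pairPolar
    split_ifs with h1 h2
    · rw [← hx]; congr 1; exact Fin.ext h1
    · rw [← hy]; congr 1; exact Fin.ext h2
    · exact h i h1 h2

/-- The polar coordinates in which only the strands `k` and `k + 1` change their distance from the
center, staying between their starting points, and pass each other, when they are at the same
distance, with a difference of angles between `0` and `2π / m`. -/
def twistRegion (m k : ℕ) (hk : k + 1 < n) : Set (Fin n → ℝ × ℝ) :=
  {v | (∀ i : Fin n, (i : ℕ) ≠ k → (i : ℕ) ≠ k + 1 → (v i).1 = strandRadius n i) ∧
    (v ⟨k, Nat.lt_of_succ_lt hk⟩).1 ∈ Set.Icc (strandRadius n ⟨k, Nat.lt_of_succ_lt hk⟩)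
      (strandRadius n ⟨k + 1, hk⟩) ∧
    (v ⟨k + 1, hk⟩).1 ∈ Set.Icc (strandRadius n ⟨k, Nat.lt_of_succ_lt hk⟩)
      (strandRadius n ⟨k + 1, hk⟩) ∧
    ((v ⟨k, Nat.lt_of_succ_lt hk⟩).1 = (v ⟨k + 1, hk⟩).1 →
      (v ⟨k + 1, hk⟩).2 - (v ⟨k, Nat.lt_of_succ_lt hk⟩).2 ∈ Set.Ioo 0 (2 * Real.pi / m))}

/-- The strands `k` and `k + 1` stay in the closed annulus between their two base radii, and all
other strands have radii outside it. So these two are the only pair that can reach equal radii. -/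
theorem twistRegion_subset (k : ℕ) (hk : k + 1 < n) :
    twistRegion m k hk ⊆ polarRegion n m := by
  rintro v ⟨h0, ha, hb, h⟩
  set a : Fin n := ⟨k, Nat.lt_of_succ_lt hk⟩ with hadef
  set b : Fin n := ⟨k + 1, hk⟩ with hbdef
  have ea : ∀ i : Fin n, (i : ℕ) = k → i = a := fun i hi => Fin.ext hi
  have eb : ∀ i : Fin n, (i : ℕ) = k + 1 → i = b := fun i hi => Fin.ext hi
  have hm := strandRadius_strictMono n
  refine ⟨fun i => ?_, fun i j hij hr => ?_⟩
  · by_cases hi : (i : ℕ) = k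
    · rw [ea i hi]
      exact ⟨(strandRadius_mem n a).1.trans ha.1, ha.2.trans (strandRadius_mem n b).2⟩
    by_cases hi' : (i : ℕ) = k + 1
    · rw [eb i hi']
      exact ⟨(strandRadius_mem n a).1.trans hb.1, hb.2.trans (strandRadius_mem n b).2⟩
    · rw [h0 i hi hi']
      exact strandRadius_mem n i
  · have hij' : (i : ℕ) < j := hij
    have low : ∀ l : Fin n, (l : ℕ) < k → (v l).1 < strandRadius n a := fun l hl => by
      rw [h0 l (by omega) (by omega)]
      exact hm (Fin.lt_def.2 hl)
    have high : ∀ l : Fin n, k + 1 < (l : ℕ) → strandRadius n b < (v l).1 := fun l hl => by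
      rw [h0 l (by omega) (by omega)]
      exact hm (Fin.lt_def.2 hl)
    rcases lt_or_ge (i : ℕ) k with hi | hi
    · exfalso
      rcases lt_or_ge (k + 1) (j : ℕ) with hj | hj
      · rw [h0 i (by omega) (by omega), h0 j (by omega) (by omega)] at hr
        exact hij.ne (hm.injective hr)
      have := low i hi
      by_cases hj1 : (j : ℕ) = k
      · rw [ea j hj1] at hr
        linarith [ha.1]
      by_cases hj2 : (j : ℕ) = k + 1
      · rw [eb j hj2] at hr
        linarith [hb.1]
      rw [h0 i (by omega) (by omega), h0 j (by omega) (by omega)] at hr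
      exact hij.ne (hm.injective hr)
    rcases lt_or_ge (k + 1) (j : ℕ) with hj | hj
    · exfalso
      have := high j hj
      by_cases hi1 : (i : ℕ) = k
      · rw [ea i hi1] at hr
        linarith [ha.2]
      by_cases hi2 : (i : ℕ) = k + 1
      · rw [eb i hi2] at hr
        linarith [hb.2]
      rw [h0 i (by omega) (by omega), h0 j (by omega) (by omega)] at hr
      exact hij.ne (hm.injective hr)
    rw [ea i (by omega), eb j (by omega)] at hr ⊢
    exact ⟨(strandRadius_pos n a).trans_le ha.1, h hr⟩

/-- The center puts both strands at the middle radius with angular gap `π/m`, the midpoint of the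
allowed interval. On the segment to `v` the difference of the two radii is a multiple of that of
`v`, so radii agree away from the center only if they agree at `v`; then both gaps are allowed, and
so is every convex combination. -/
theorem starConvex_twistRegion [NeZero m] (k : ℕ) (hk : k + 1 < n) :
    StarConvex ℝ (pairPolar n k
      (((strandRadius n ⟨k, Nat.lt_of_succ_lt hk⟩ + strandRadius n ⟨k + 1, hk⟩) / 2, 0))
      (((strandRadius n ⟨k, Nat.lt_of_succ_lt hk⟩ + strandRadius n ⟨k + 1, hk⟩) / 2,
        Real.pi / m))) (twistRegion m k hk) := by
  obtain ⟨ca, cb, c0⟩ := (pairPolar_eq_iff hk).1 (rfl : pairPolar n k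
      (((strandRadius n ⟨k, Nat.lt_of_succ_lt hk⟩ + strandRadius n ⟨k + 1, hk⟩) / 2, 0))
      (((strandRadius n ⟨k, Nat.lt_of_succ_lt hk⟩ + strandRadius n ⟨k + 1, hk⟩) / 2,
        Real.pi / m)) = _)
  have hlt : strandRadius n ⟨k, Nat.lt_of_succ_lt hk⟩ < strandRadius n ⟨k + 1, hk⟩ :=
    strandRadius_strictMono n (Fin.lt_def.2 (Nat.lt_succ_self k))
  have hpi : 0 < Real.pi / m :=
    div_pos Real.pi_pos (by exact_mod_cast Nat.pos_of_ne_zero (NeZero.ne m))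
  rintro v ⟨h0, ha, hb, h⟩ s t hs ht hst
  have conv := convex_Icc (𝕜 := ℝ) (strandRadius n ⟨k, Nat.lt_of_succ_lt hk⟩)
    (strandRadius n ⟨k + 1, hk⟩)
  refine ⟨fun i hi hi' => ?_, ?_, ?_, fun hr => ?_⟩
  · simp only [Pi.add_apply, Pi.smul_apply, Prod.fst_add, Prod.smul_fst, h0 i hi hi', c0 i hi hi',
      smul_eq_mul]
    rw [← add_mul, hst, one_mul]
  · simp only [Pi.add_apply, Pi.smul_apply, Prod.fst_add, Prod.smul_fst, ca]
    exact conv ⟨by linarith, by linarith⟩ ha hs ht hst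
  · simp only [Pi.add_apply, Pi.smul_apply, Prod.fst_add, Prod.smul_fst, cb]
    exact conv ⟨by linarith, by linarith⟩ hb hs ht hst
  · simp only [Pi.add_apply, Pi.smul_apply, Prod.fst_add, Prod.smul_fst, Prod.snd_add,
      Prod.smul_snd, ca, cb, smul_eq_mul] at hr ⊢
    -- For weight `t = 0` the point is the center itself and nothing is known about the angles of
    -- `v`; otherwise `t` cancels from the equality of radii.
    rcases ht.eq_or_lt with rfl | ht'
    · obtain rfl : s = 1 := by linarith
      constructor
      · simpa using hpi
      · have : 2 * Real.pi / m = 2 * (Real.pi / m) := by ring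
        rw [this]
        linarith
    · obtain ⟨h1, h2⟩ := h (mul_left_cancel₀ ht'.ne' (add_left_cancel hr))
      have key := (convex_Ioo (𝕜 := ℝ) (0 : ℝ) (2 * Real.pi / m)) (x := Real.pi / m)
        ⟨hpi, by have : 2 * Real.pi / m = 2 * (Real.pi / m) := by ring
                 rw [this]; linarith⟩ ⟨h1, h2⟩ hs ht hst
      simp only [smul_eq_mul] at key
      convert key using 1
      ring

theorem pairPolar_mem_twistRegion {k : ℕ} (hk : k + 1 < n) {x y : ℝ × ℝ}
    (hx : x.1 ∈ Set.Icc (strandRadius n ⟨k, Nat.lt_of_succ_lt hk⟩) (strandRadius n ⟨k + 1, hk⟩))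
    (hy : y.1 ∈ Set.Icc (strandRadius n ⟨k, Nat.lt_of_succ_lt hk⟩) (strandRadius n ⟨k + 1, hk⟩))
    (h : x.1 = y.1 → y.2 - x.2 ∈ Set.Ioo 0 (2 * Real.pi / m)) :
    pairPolar n k x y ∈ twistRegion m k hk := by
  obtain ⟨ha, hb, h0⟩ := (pairPolar_eq_iff hk).1 (rfl : pairPolar n k x y = _)
  refine ⟨fun i hi hi' => by rw [h0 i hi hi'], ?_, ?_, ?_⟩
  · rwa [ha]
  · rwa [hb]
  · rwa [ha, hb]

/-! ### The half twist in polar coordinates. -/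

/-- Polar coordinates of the inner strand during a half twist. -/
def twistOut (n m k : ℕ) (t : ℝ) : ℝ × ℝ :=
  (((k : ℝ) + 3 / 2 - Real.cos (Real.pi * t) / 2) / ((n : ℝ) + 1),
    -(Real.pi / (2 * m) * Real.sin (Real.pi * t)))

/-- Polar coordinates of the outer strand during a half twist. -/
def twistIn (n m k : ℕ) (t : ℝ) : ℝ × ℝ :=
  (((k : ℝ) + 3 / 2 + Real.cos (Real.pi * t) / 2) / ((n : ℝ) + 1),
    Real.pi / (2 * m) * Real.sin (Real.pi * t))

@[fun_prop]
theorem continuous_twistOut (n m k : ℕ) : Continuous (twistOut n m k) := by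
  unfold twistOut
  fun_prop

@[fun_prop]
theorem continuous_twistIn (n m k : ℕ) : Continuous (twistIn n m k) := by
  unfold twistIn
  fun_prop

section Endpoints

variable {k : ℕ} (hk : k + 1 < n)

theorem twistOut_zero : twistOut n m k 0 = (strandRadius n ⟨k, Nat.lt_of_succ_lt hk⟩, 0) := by
  simp [twistOut, strandRadius]; ring

theorem twistOut_one : twistOut n m k 1 = (strandRadius n ⟨k + 1, hk⟩, 0) := by
  simp [twistOut, strandRadius]; ring

theorem twistIn_zero : twistIn n m k 0 = (strandRadius n ⟨k + 1, hk⟩, 0) := by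
  simp [twistIn, strandRadius]; ring

theorem twistIn_one : twistIn n m k 1 = (strandRadius n ⟨k, Nat.lt_of_succ_lt hk⟩, 0) := by
  simp [twistIn, strandRadius]; ring

theorem twistOut_fst_mem (t : ℝ) : (twistOut n m k t).1 ∈
    Set.Icc (strandRadius n ⟨k, Nat.lt_of_succ_lt hk⟩) (strandRadius n ⟨k + 1, hk⟩) := by
  have h1 := Real.cos_le_one (Real.pi * t)
  have h2 := Real.neg_one_le_cos (Real.pi * t)
  have hn : (0 : ℝ) < (n : ℝ) + 1 := by positivity
  constructor <;> simp only [twistOut, strandRadius] <;>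
    refine (div_le_div_iff_of_pos_right hn).2 ?_ <;> push_cast <;> linarith

theorem twistIn_fst_mem (t : ℝ) : (twistIn n m k t).1 ∈
    Set.Icc (strandRadius n ⟨k, Nat.lt_of_succ_lt hk⟩) (strandRadius n ⟨k + 1, hk⟩) := by
  have h1 := Real.cos_le_one (Real.pi * t)
  have h2 := Real.neg_one_le_cos (Real.pi * t)
  have hn : (0 : ℝ) < (n : ℝ) + 1 := by positivity
  constructor <;> simp only [twistIn, strandRadius] <;>
    refine (div_le_div_iff_of_pos_right hn).2 ?_ <;> push_cast <;> linarith

end Endpoints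

/-- Equal radii mean `cos (π t) = 0`. That `t` lies in the unit interval makes the sine `1` rather
than `-1`, so the strand moving inwards is ahead by exactly `π/m`. -/
theorem twist_snd_of_fst_eq [NeZero m] {k : ℕ} {t : I}
    (h : (twistOut n m k t).1 = (twistIn n m k t).1) :
    (twistOut n m k t).2 = -(Real.pi / m / 2) ∧ (twistIn n m k t).2 = Real.pi / m / 2 := by
  have hn : ((n : ℝ) + 1) ≠ 0 := by positivity
  simp only [twistOut, twistIn] at h ⊢
  rw [div_left_inj' hn] at h
  have hc : Real.cos (Real.pi * t) = 0 := by linarith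
  have h0 : 0 ≤ Real.sin (Real.pi * t) :=
    Real.sin_nonneg_of_nonneg_of_le_pi (mul_nonneg Real.pi_pos.le t.2.1)
      (mul_le_of_le_one_right Real.pi_pos.le t.2.2)
  have hs : Real.sin (Real.pi * t) = 1 := by
    have := Real.sin_sq_add_cos_sq (Real.pi * t)
    rw [hc] at this
    nlinarith
  rw [hs]
  constructor <;> ring

/-- The path of the half twist in polar coordinates. -/
def twistPolarPath (m : ℕ) {k : ℕ} (hk : k + 1 < n) :
    Path (basePolar n) (pairPolar n k (strandRadius n ⟨k + 1, hk⟩, 0)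
      (strandRadius n ⟨k, Nat.lt_of_succ_lt hk⟩, 0)) where
  toFun t := pairPolar n k (twistOut n m k t) (twistIn n m k t)
  continuous_toFun := continuous_pairPolar (by fun_prop) (by fun_prop)
  source' := by
    rw [Set.Icc.coe_zero, twistOut_zero hk, twistIn_zero hk]
    exact ((pairPolar_eq_iff hk).2 ⟨rfl, rfl, fun _ _ _ => rfl⟩).symm
  target' := by rw [Set.Icc.coe_one, twistOut_one hk, twistIn_one hk]

theorem hBraid_polarRep (m : ℕ) [NeZero m] {k : ℕ} (hk : k + 1 < n) :
    PolarRep (hBraid n m k hk) (twistPolarPath m hk) := by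
  refine ⟨hPath n m k hk, rfl, fun t i => ?_⟩
  change (twistRadius n k t i : ℂ) * Complex.exp ((twistAngle n m k t i : ℂ) * Complex.I) =
    ((pairPolar n k (twistOut n m k t) (twistIn n m k t) i).1 : ℂ) *
      Complex.exp (((pairPolar n k (twistOut n m k t) (twistIn n m k t) i).2 : ℂ) * Complex.I)
  unfold twistRadius twistAngle pairPolar twistOut twistIn
  split_ifs <;> rfl

/-- Both sides lift to paths in `twistRegion` with the same end points. The point is that the two
crossings in the product happen with the same gap `π/m` between the lifted angles, so strand `k + 1`
enters and leaves between the same two rotated images of strand `k`. -/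
theorem hBraid_mul_rotBraid_mul_hBraid (m : ℕ) [NeZero m] {k : ℕ} (hk : k + 1 < n) :
    hBraid n m k hk * rotBraid m (Pi.single ⟨k, Nat.lt_of_succ_lt hk⟩ 1) * hBraid n m k hk =
      rotBraid m (Pi.single ⟨k + 1, hk⟩ 1) := by
  set a : Fin n := ⟨k, Nat.lt_of_succ_lt hk⟩ with ha
  set b : Fin n := ⟨k + 1, hk⟩ with hb
  have hab : a ≠ b := fun h => by simpa [ha, hb] using congrArg Fin.val h
  have hpi : 0 < Real.pi / m :=
    div_pos Real.pi_pos (by exact_mod_cast Nat.pos_of_ne_zero (NeZero.ne m))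
  have h2pi : 2 * Real.pi / m = Real.pi / m + Real.pi / m := by ring
  have hlt : strandRadius n a < strandRadius n b :=
    strandRadius_strictMono n (Fin.lt_def.2 (Nat.lt_succ_self k))
  have cases3 : ∀ i : Fin n, i = a ∨ i = b ∨ ((i : ℕ) ≠ k ∧ (i : ℕ) ≠ k + 1 ∧ i ≠ a ∧ i ≠ b) := by
    intro i
    have h1 : i = a ↔ (i : ℕ) = k := Fin.ext_iff
    have h2 : i = b ↔ (i : ℕ) = k + 1 := Fin.ext_iff
    rw [Ne, Ne, h1, h2]
    omega
  -- The middle leg: after the first half twist strand `k + 1` occupies the inner place, so it is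
  -- the strand that turns.
  let γ : Path (pairPolar n k (strandRadius n b, 0) (strandRadius n a, 0))
      (pairPolar n k (strandRadius n b, 0) (strandRadius n a, 2 * Real.pi / m)) :=
    { toFun := fun t => pairPolar n k (strandRadius n b, 0) (strandRadius n a, 2 * Real.pi / m * t)
      continuous_toFun := continuous_pairPolar (by fun_prop) (by fun_prop)
      source' := by simp
      target' := by simp }
  -- The last leg: the strands have changed roles, and the angle of strand `k + 1` continues from
  -- `2π/m` instead of starting again at `0`.
  let δ : Path (pairPolar n k (strandRadius n b, 0) (strandRadius n a, 2 * Real.pi / m))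
      (pairPolar n k (strandRadius n a, 0) (strandRadius n b, 2 * Real.pi / m)) :=
    { toFun := fun t => pairPolar n k (twistIn n m k t)
        ((twistOut n m k t).1, (twistOut n m k t).2 + 2 * Real.pi / m)
      continuous_toFun := continuous_pairPolar (by fun_prop) (by fun_prop)
      source' := by rw [Set.Icc.coe_zero, twistOut_zero hk, twistIn_zero hk, zero_add]
      target' := by rw [Set.Icc.coe_one, twistOut_one hk, twistIn_one hk, zero_add] }
  have hγ := (hBraid_polarRep m hk).mul (rotBraid_polarRep m (Pi.single a 1)) γ (fun t i => by
    obtain ⟨ga, gb, g0⟩ := (pairPolar_eq_iff hk).1 (rfl : γ t = pairPolar n k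
      (strandRadius n b, 0) (strandRadius n a, 2 * Real.pi / m * t))
    change _ = strandRadius n ((Equiv.swap a b)⁻¹ i) ∧ _ = (1 : ℂ) *
      Complex.exp (((2 * Real.pi / m * (Pi.single a 1 : Fin n → ℕ) ((Equiv.swap a b)⁻¹ i) *
        (t : ℝ) : ℝ) : ℂ) * Complex.I)
    rw [Equiv.swap_inv]
    rcases cases3 i with rfl | rfl | ⟨h1, h2, h3, h4⟩
    · rw [Equiv.swap_apply_left, Pi.single_eq_of_ne hab.symm, ga]
      simp
    · rw [Equiv.swap_apply_right, Pi.single_eq_same, gb]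
      simp
    · rw [Equiv.swap_apply_of_ne_of_ne h3 h4, Pi.single_eq_of_ne h3, g0 i h1 h2]
      simp)
  have hδ := hγ.mul (hBraid_polarRep m hk) δ (fun t i => by
    obtain ⟨ga, gb, g0⟩ := (pairPolar_eq_iff hk).1 (rfl : δ t = pairPolar n k (twistIn n m k t)
        ((twistOut n m k t).1, (twistOut n m k t).2 + 2 * Real.pi / m))
    obtain ⟨ga', gb', g0'⟩ := (pairPolar_eq_iff hk).1 (rfl : pairPolar n k (twistOut n m k t)
      (twistIn n m k t) = _)
    change _ = (pairPolar n k (twistOut n m k t) (twistIn n m k t)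
        ((Equiv.swap a b * 1)⁻¹ i)).1 ∧
      _ = (((1 * rotGen m ^ (Pi.single a 1 : Fin n → ℕ) ((Equiv.swap a b)⁻¹ i) :
        rootsOfUnity m ℂ) : ℂˣ) : ℂ) * Complex.exp (((pairPolar n k (twistOut n m k t)
          (twistIn n m k t) ((Equiv.swap a b * 1)⁻¹ i)).2 : ℂ) * Complex.I)
    rw [mul_one, Equiv.swap_inv, one_mul, rotGen_pow_val]
    rcases cases3 i with rfl | rfl | ⟨h1, h2, h3, h4⟩
    · rw [Equiv.swap_apply_left, Pi.single_eq_of_ne hab.symm, ga, gb']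
      simp
    · rw [Equiv.swap_apply_right, Pi.single_eq_same, gb, ga', ← Complex.exp_add]
      refine ⟨rfl, ?_⟩
      congr 1
      push_cast
      ring
    · rw [Equiv.swap_apply_of_ne_of_ne h3 h4, Pi.single_eq_of_ne h3, g0 i h1 h2, g0' i h1 h2]
      simp)
  refine hδ.eq (rotBraid_polarRep m (Pi.single b 1)) ?_ ?_ (starConvex_twistRegion (m := m) k hk)
    (twistRegion_subset k hk) (Path.trans_mem (Path.trans_mem (fun t => ?_) (fun t => ?_))
      (fun t => ?_)) (fun t => ?_)
  · refine SemidirectProduct.ext (funext fun i => ?_) ?_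
    · change 1 * rotGen m ^ (Pi.single a 1 : Fin n → ℕ) ((Equiv.swap a b)⁻¹ i) * 1 =
        rotGen m ^ (Pi.single b 1 : Fin n → ℕ) i
      rw [one_mul, mul_one, Equiv.swap_inv]
      rcases cases3 i with rfl | rfl | ⟨h1, h2, h3, h4⟩
      · rw [Equiv.swap_apply_left, Pi.single_eq_of_ne hab.symm, Pi.single_eq_of_ne hab]
      · rw [Equiv.swap_apply_right, Pi.single_eq_same, Pi.single_eq_same]
      · rw [Equiv.swap_apply_of_ne_of_ne h3 h4, Pi.single_eq_of_ne h3, Pi.single_eq_of_ne h4]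
    · change Equiv.swap a b * 1 * Equiv.swap a b = 1
      rw [mul_one, Equiv.swap_mul_self]
  · refine ((pairPolar_eq_iff hk).2 ⟨?_, ?_, fun i h1 h2 => ?_⟩).symm
    · change (_, 2 * Real.pi / m * ((Pi.single b 1 : Fin n → ℕ) a : ℝ)) = _
      rw [Pi.single_eq_of_ne hab]
      simp [ha]
    · change (_, 2 * Real.pi / m * ((Pi.single b 1 : Fin n → ℕ) b : ℝ)) = _
      rw [Pi.single_eq_same]
      simp [hb]
    · rw [Pi.single_eq_of_ne (fun h => h2 (congrArg Fin.val h))]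
      simp
  · refine pairPolar_mem_twistRegion hk (twistOut_fst_mem (m := m) hk _)
      (twistIn_fst_mem (m := m) hk _) fun h => ?_
    obtain ⟨h1, h2⟩ := twist_snd_of_fst_eq h
    rw [h1, h2]
    constructor <;> linarith
  · exact pairPolar_mem_twistRegion hk ⟨hlt.le, le_rfl⟩ ⟨le_rfl, hlt.le⟩
      fun h => absurd h hlt.ne'
  -- With the roles exchanged the gap would be `-π/m`; the turn already made adds `2π/m` and brings
  -- it back to `π/m`.
  · refine pairPolar_mem_twistRegion hk (twistIn_fst_mem (m := m) hk _)
      (twistOut_fst_mem (m := m) hk _) fun h => ?_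
    obtain ⟨h1, h2⟩ := twist_snd_of_fst_eq h.symm
    dsimp only
    rw [h1, h2]
    constructor <;> linarith
  · have h : ∀ i, (rotPolarPath m (Pi.single b 1) t i).1 = strandRadius n i := fun _ => rfl
    refine ⟨fun i _ _ => h i, ?_, ?_, fun h' => ?_⟩
    · rw [h]; exact ⟨le_rfl, hlt.le⟩
    · rw [h]; exact ⟨hlt.le, le_rfl⟩
    · rw [h, h] at h'
      exact absurd h' hlt.ne

/-! ### Identification of `θ_n` with the rotation of all strands. -/

theorem gammaBraid_eq_rotBraid (m : ℕ) [NeZero m] (k : Fin n) :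
    gammaBraid n m k = rotBraid m (Pi.single k 1) := by
  obtain ⟨k, hk⟩ := k
  induction k with
  | zero =>
    rw [← uBraid_eq_rotBraid m hk]
    simp [gammaBraid]
  | succ k ih =>
    rw [← hBraid_mul_rotBraid_mul_hBraid m hk, ← ih (Nat.lt_of_succ_lt hk)]
    -- Splitting off the last half twist from both lists leaves the previous `γ` in the middle.
    simp only [gammaBraid, List.ofFn_succ', List.concat_eq_append, List.reverse_append,
      List.prod_append, List.reverse_singleton, List.prod_singleton, Fin.val_last,
      Fin.val_castSucc, mul_assoc]

theorem thetaBraid_eq_rotBraid (n m : ℕ) [NeZero m] :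
    thetaBraid n m = rotBraid m (1 : Fin n → ℕ) := by
  have h : (List.ofFn fun k : Fin n => gammaBraid n m k) =
      (List.ofFn fun k : Fin n => Multiplicative.ofAdd (Pi.single k 1 : Fin n → ℕ)).map
        (rotHom n m) := by
    rw [List.map_ofFn]
    congr 1
    funext k
    exact gammaBraid_eq_rotBraid m k
  -- The order of the factors may be forgotten once the product is pulled back along `rotHom` to a
  -- commutative monoid.
  rw [thetaBraid, h, ← List.map_reverse, ← map_list_prod, (List.reverse_perm _).prod_eq,
    List.prod_ofFn, ← ofAdd_sum]
  change rotBraid m (∑ k : Fin n, (Pi.single k 1 : Fin n → ℕ)) = _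
  congr 1
  exact Finset.univ_sum_single (1 : Fin n → ℕ)

/-! ### Centrality of the full rotation -/

/-- The rotation of all strands by the angle `φ`. -/
def rotateConfiguration [NeZero m] (φ : ℝ) (x : OrbitConfiguration (rootsOfUnity m ℂ) ConeDisk n) :
    OrbitConfiguration (rootsOfUnity m ℂ) ConeDisk n :=
  ⟨fun i => ⟨Complex.exp (φ * Complex.I) * (x.1 i : ℂ), by
    have hz := (x.1 i).2
    rw [mem_closedBall_zero_iff] at hz ⊢
    rwa [norm_mul, Complex.norm_exp_ofReal_mul_I, one_mul]⟩, fun i j hij g h => by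
    refine x.2 i j hij g (Subtype.ext ?_)
    have h' : Complex.exp (φ * Complex.I) * (x.1 i : ℂ) =
      ((g : ℂˣ) : ℂ) * (Complex.exp (φ * Complex.I) * (x.1 j : ℂ)) := congrArg Subtype.val h
    rw [mul_left_comm] at h'
    exact mul_left_cancel₀ (Complex.exp_ne_zero _) h'⟩

theorem continuous_rotateConfiguration [NeZero m] :
    Continuous fun q : ℝ × OrbitConfiguration (rootsOfUnity m ℂ) ConeDisk n =>
      rotateConfiguration q.1 q.2 := by
  refine Continuous.subtype_mk (continuous_pi fun i => Continuous.subtype_mk ?_ _) _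
  have h : Continuous fun q : ℝ × OrbitConfiguration (rootsOfUnity m ℂ) ConeDisk n =>
      ((q.2.1 i : ConeDisk) : ℂ) :=
    continuous_subtype_val.comp ((continuous_apply i).comp
      (continuous_subtype_val.comp continuous_snd))
  fun_prop

/-- The rotation is the same on all strands, so it commutes with permuting them and with multiplying
each by its own root of unity. The two products are then images of the two ways around a square from
`(0, 0)` to `(1, 1)`. -/
theorem rotBraid_one_mul_comm [NeZero m] (b : DiskBraidGroup n m) :
    rotBraid m (1 : Fin n → ℕ) * b = b * rotBraid m 1 := by
  obtain ⟨w, p, rfl⟩ := ofPath_surjective b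
  have helt : rotElt m (1 : Fin n → ℕ) * w = w * rotElt m 1 := by
    refine SemidirectProduct.ext (funext fun i => ?_) ?_
    · change rotGen m ^ 1 * w.left i = w.left i * rotGen m ^ 1
      exact mul_comm _ _
    · exact (one_mul w.right).trans (mul_one w.right).symm
  rw [rotBraid, ofPath_mul_ofPath, ofPath_mul_ofPath]
  refine ofPath_eq_ofPath helt ?_
  -- Extending `p` to the real line makes the whole plane, which is simply connected, the source of
  -- `F`.
  let F : ℝ × ℝ → OrbitConfiguration (rootsOfUnity m ℂ) ConeDisk n :=
    fun q => rotateConfiguration (2 * Real.pi / m * q.1) (p.extend q.2)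
  have hF : Continuous F := by
    refine continuous_rotateConfiguration.comp (Continuous.prodMk (by fun_prop) ?_)
    exact p.continuous_extend.comp continuous_snd
  let α₁ : Path ((0, 0) : ℝ × ℝ) (1, 0) :=
    ⟨⟨fun t => (t, 0), by fun_prop⟩, by simp, by simp⟩
  let α₂ : Path ((1, 0) : ℝ × ℝ) (1, 1) :=
    ⟨⟨fun t => (1, t), by fun_prop⟩, by simp, by simp⟩
  let β₁ : Path ((0, 0) : ℝ × ℝ) (0, 1) :=
    ⟨⟨fun t => (0, t), by fun_prop⟩, by simp, by simp⟩
  let β₂ : Path ((0, 1) : ℝ × ℝ) (1, 1) :=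
    ⟨⟨fun t => (t, 1), by fun_prop⟩, by simp, by simp⟩
  have angle (t : I) (i : Fin n) : 2 * Real.pi / m * ((1 : Fin n → ℕ) i : ℝ) * (t : ℝ) =
      2 * Real.pi / m * (t : ℝ) := by simp
  have hα₁ (s : I) : rotPath m (1 : Fin n → ℕ) s = F (α₁ s) := by
    refine Subtype.ext (funext fun i => Subtype.ext ?_)
    change (strandRadius n i : ℂ) * Complex.exp (((2 * Real.pi / m *
      ((1 : Fin n → ℕ) i : ℝ) * (s : ℝ) : ℝ) : ℂ) * Complex.I) =
      Complex.exp (((2 * Real.pi / m * (s : ℝ) : ℝ) : ℂ) * Complex.I) * ((p.extend 0).1 i : ℂ)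
    rw [p.extend_zero, angle, mul_comm]
    simp [baseConfiguration, ConeDisk.polar]
  have hα₂ (s : I) : rotElt m (1 : Fin n → ℕ) • p s = F (α₂ s) := by
    refine Subtype.ext (funext fun i => Subtype.ext ?_)
    change (((rotGen m ^ 1 : rootsOfUnity m ℂ) : ℂˣ) : ℂ) * ((p s).1 i : ℂ) =
      Complex.exp (((2 * Real.pi / m * 1 : ℝ) : ℂ) * Complex.I) * ((p.extend (s : ℝ)).1 i : ℂ)
    rw [Path.extend_apply _ s.2, rotGen_pow_val, Nat.cast_one]
  have hβ₁ (s : I) : p s = F (β₁ s) := by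
    refine Subtype.ext (funext fun i => Subtype.ext ?_)
    change ((p s).1 i : ℂ) =
      Complex.exp (((2 * Real.pi / m * 0 : ℝ) : ℂ) * Complex.I) * ((p.extend (s : ℝ)).1 i : ℂ)
    rw [Path.extend_apply _ s.2]
    simp
  have hβ₂ (s : I) : w • rotPath m (1 : Fin n → ℕ) s = F (β₂ s) := by
    refine Subtype.ext (funext fun i => Subtype.ext ?_)
    change _ * ((strandRadius n _ : ℂ) * Complex.exp (((2 * Real.pi / m *
      ((1 : Fin n → ℕ) _ : ℝ) * (s : ℝ) : ℝ) : ℂ) * Complex.I)) =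
      Complex.exp (((2 * Real.pi / m * (s : ℝ) : ℝ) : ℂ) * Complex.I) * ((p.extend 1).1 i : ℂ)
    rw [p.extend_one, OrbitConfiguration.smul_val, ConeDisk.smul_val, angle]
    simp only [baseConfiguration, ConeDisk.polar, Complex.ofReal_zero, zero_mul, Complex.exp_zero]
    ring
  refine Path.Homotopic.of_lift hF (α₁.trans α₂) (β₁.trans β₂) (fun t => ?_) (fun t => ?_)
  · rw [Path.cast_coe, Path.trans_apply, Path.trans_apply]
    split_ifs with h
    · exact hα₁ _
    · exact hα₂ _
  · rw [Path.cast_coe, Path.cast_coe, Path.trans_apply, Path.trans_apply]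
    split_ifs with h
    · exact hβ₁ _
    · exact hβ₂ _

/-! ### The winding number of two strands -/

/-- Equal `m`-th powers mean that the quotient of the two points is an `m`-th root of unity, hence a
common orbit. The cone point is its own orbit and is treated apart. -/
theorem pow_sub_pow_ne_zero [NeZero m] (x : OrbitConfiguration (rootsOfUnity m ℂ) ConeDisk n)
    {i j : Fin n} (hij : i ≠ j) : (x.1 i : ℂ) ^ m - (x.1 j : ℂ) ^ m ≠ 0 := by
  intro h
  have h' : (x.1 i : ℂ) ^ m = (x.1 j : ℂ) ^ m := sub_eq_zero.1 h
  by_cases h0 : (x.1 j : ℂ) = 0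
  · rw [h0, zero_pow (NeZero.ne m)] at h'
    refine x.2 i j hij 1 (Subtype.ext ?_)
    rw [one_smul, h0, eq_zero_of_pow_eq_zero h']
  · have hr : ((x.1 i : ℂ) / (x.1 j : ℂ)) ^ m = 1 := by
      rw [div_pow, h', div_self (pow_ne_zero m h0)]
    refine x.2 i j hij (rootsOfUnity.mkOfPowEq _ hr) (Subtype.ext ?_)
    rw [ConeDisk.smul_val, rootsOfUnity.coe_mkOfPowEq, div_mul_cancel₀ _ h0]

/-- The direction of the difference of the `m`-th powers of the strands `i` and `j`. -/
def relativeDirection [NeZero m] {i j : Fin n} (hij : i ≠ j) :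
    C(OrbitConfiguration (rootsOfUnity m ℂ) ConeDisk n, Circle) where
  toFun x := ⟨((x.1 i : ℂ) ^ m - (x.1 j : ℂ) ^ m) / ‖(x.1 i : ℂ) ^ m - (x.1 j : ℂ) ^ m‖, by
    rw [Submonoid.unitSphere, Submonoid.mem_mk, Subsemigroup.mem_mk, mem_sphere_zero_iff_norm,
      norm_div, Complex.norm_real, norm_norm,
      div_self (norm_ne_zero_iff.2 (pow_sub_pow_ne_zero x hij))]⟩
  continuous_toFun := by
    refine Continuous.subtype_mk ?_ _
    have h (k : Fin n) : Continuous fun x : OrbitConfiguration (rootsOfUnity m ℂ) ConeDisk n =>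
        ((x.1 k : ConeDisk) : ℂ) :=
      continuous_subtype_val.comp ((continuous_apply k).comp continuous_subtype_val)
    have h' := ((h i).pow m).sub ((h j).pow m)
    exact h'.div (Complex.continuous_ofReal.comp h'.norm) fun x => by
      simpa using pow_sub_pow_ne_zero x hij

/-- A common turn by `2πk/m` multiplies both `m`-th powers by the same `exp(2πikt)`, while the
difference of the moduli stays a positive constant. -/
theorem relativeDirection_rotPath [NeZero m] {i j : Fin n} (hij : j < i) (k : ℕ) (t : I) :
    relativeDirection hij.ne' (rotPath m (fun _ => k) t) = Circle.exp (2 * Real.pi * k * t) := by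
  refine Subtype.ext ?_
  have hpow (l : Fin n) : (((rotPath m (fun _ => k) t).1 l : ConeDisk) : ℂ) ^ m =
      ((strandRadius n l ^ m : ℝ) : ℂ) *
        Complex.exp (((2 * Real.pi * k * t : ℝ) : ℂ) * Complex.I) := by
    change ((strandRadius n l : ℂ) *
      Complex.exp (((2 * Real.pi / m * k * (t : ℝ) : ℝ) : ℂ) * Complex.I)) ^ m = _
    rw [mul_pow, ← Complex.exp_nat_mul, Complex.ofReal_pow]
    have hm : (m : ℂ) ≠ 0 := by exact_mod_cast NeZero.ne m
    congr 2
    push_cast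
    field_simp
  have hpos : 0 < strandRadius n i ^ m - strandRadius n j ^ m :=
    sub_pos.2 (pow_lt_pow_left₀ (strandRadius_strictMono n hij) (strandRadius_pos n j).le
      (NeZero.ne m))
  change (_ ^ m - _ ^ m : ℂ) / (‖(_ ^ m - _ ^ m : ℂ)‖ : ℂ) = _
  rw [hpow, hpow, ← sub_mul, norm_mul, Complex.norm_exp_ofReal_mul_I, mul_one,
    ← Complex.ofReal_sub, Complex.norm_real, Real.norm_of_nonneg hpos.le, mul_div_right_comm,
    div_self (by exact_mod_cast hpos.ne'), one_mul, Circle.coe_exp]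

/-- The case of no turns at time `0`; it provides the starting point `0` of the lifts to `ℝ`. -/
theorem relativeDirection_base [NeZero m] {i j : Fin n} (hij : j < i) :
    relativeDirection hij.ne' (baseConfiguration n m) = Circle.exp 0 := by
  have h := relativeDirection_rotPath (m := m) hij 0 0
  rw [Path.source] at h
  simpa using h

/-- The total change of the argument of the difference of the `m`-th powers of the strands
`i` and `j`. -/
def windingAngle [NeZero m] {i j : Fin n} (hij : j < i) (a : DiskBraidGroup n m) : ℝ :=
  (Circle.isCoveringMap_exp.monodromy (a.cls.map (relativeDirection hij.ne'))
    ⟨0, (relativeDirection_base hij).symm⟩).1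

theorem windingAngle_rotBraid [NeZero m] {i j : Fin n} (hij : j < i) (k : ℕ) :
    windingAngle hij (rotBraid m (fun _ => k)) = 2 * Real.pi * k := by
  -- The lift through `Circle.exp` is explicit; by uniqueness of lifts its end point is the
  -- monodromy.
  let Γ : C(I, ℝ) := ⟨fun t => 2 * Real.pi * k * t, by fun_prop⟩
  have h := (Circle.isCoveringMap_exp.eq_liftPath_iff'
    (γ := ((rotPath m (fun _ : Fin n => k)).map
      (relativeDirection hij.ne').continuous).toContinuousMap)
    (e := 0) (by
      change relativeDirection hij.ne' (rotPath m (fun _ : Fin n => k) 0) = _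
      rw [Path.source]
      exact relativeDirection_base hij) (Γ := Γ)).2
    ⟨funext fun t => (relativeDirection_rotPath hij k t).symm, by simp [Γ]⟩
  refine (DFunLike.congr_fun h 1).symm.trans ?_
  simp [Γ]

theorem not_isOfFinOrder_rotBraid_one [NeZero m] (hn : 2 ≤ n) :
    ¬ IsOfFinOrder (rotBraid m (1 : Fin n → ℕ)) := by
  rw [isOfFinOrder_iff_pow_eq_one]
  rintro ⟨k, hk, h⟩
  have hpow : rotBraid m (1 : Fin n → ℕ) ^ k = rotBraid m (fun _ => k) := by
    have := map_pow (rotHom n m) (Multiplicative.ofAdd 1) k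
    refine this.symm.trans ?_
    change rotBraid m (k • (1 : Fin n → ℕ)) = _
    congr 1
    funext i
    simp
  have hij : (⟨0, by omega⟩ : Fin n) < ⟨1, by omega⟩ := Fin.lt_def.2 Nat.zero_lt_one
  have h0 := windingAngle_rotBraid (m := m) hij 0
  have h1 := windingAngle_rotBraid (m := m) hij k
  -- A trivial `k`-th power would have winding angle both `2πk` and, as the rotation by zero turns,
  -- `0`.
  rw [← hpow, h, ← rotBraid_zero m] at h1
  have h2 : 2 * Real.pi * (k : ℝ) = 2 * Real.pi * ((0 : ℕ) : ℝ) := h1.symm.trans h0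
  have := mul_left_cancel₀ (by positivity) h2
  exact hk.ne' (by exact_mod_cast this)

end

theorem proposition4p1 (n m : ℕ) [NeZero m] (hn : 1 ≤ n) (hm : 2 ≤ m) :
    thetaBraid n m ∈ Subgroup.center (DiskBraidGroup n m) ∧
      (2 ≤ n → ¬ IsOfFinOrder (thetaBraid n m)) := by
  rw [thetaBraid_eq_rotBraid]
  exact ⟨Subgroup.mem_center_iff.2 fun b => (rotBraid_one_mul_comm b).symm,
    not_isOfFinOrder_rotBraid_one⟩
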